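/- Let $G$ be a profinite group. For $g\in G$ let $\pi(g)$ be the set of primes dividing the (Steinitz) order of the procyclic subgroup $\overline{\langle g\rangle}$. Write $[x,y]=x^{-1}y^{-1}xy$ and $[x_1,\dots,x_k]=[[x_1,\dots,x_{k-1}],x_k]$, with $[x_1]=x_1$. For $k\ge 1$ let $\mathcal U_k(G)$ be the set of uniform $k$-step commutators of $G$, that is, of the elements $[x_1,\dots,x_k]$ with $x_1,\dots,x_k\in G$ and $\pi(x_1)=\dots=\pi(x_k)$, and let $\gamma_k(G)$ be the $k$-th term of the lower central series of $G$ (as a closed subgroup, with $\gamma_1(G)=G$). There is a function $f:\mathbb N\to\mathbb N$ such that, for all integers $k\ge 1$ and $m\ge 1$ and every profinite group $G$ with $|\mathcal U_k(G)|\le m$, the subgroup $\gamma_k(G)$ is finite and $|\gamma_k(G)|\le f(m)$. -/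

import Mathlib

namespace UniformComm

/-- The order of a profinite group as a Steinitz number `∏ p ^ n(p)`, encoded by its exponents
`n(p) ∈ {0, 1, …, ∞}`: the least common multiple of the indices of the open normal subgroups. -/
noncomputable def steinitzOrder (H : Type*) [Group H] [TopologicalSpace H] : Nat.Primes → ℕ∞ :=
  fun p => ⨆ U : OpenNormalSubgroup H, emultiplicity (p : ℕ) U.toSubgroup.index

/-- The set `π(H)` of prime divisors of the order of a profinite group `H`. -/
def primeDivisors (H : Type*) [Group H] [TopologicalSpace H] : Set Nat.Primes :=
  {p | steinitzOrder H p ≠ 0}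

variable {G : Type*} [Group G]

/-- The procyclic (that is, topologically generated by one element) subgroup generated by `g`. -/
def procyclic [TopologicalSpace G] [IsTopologicalGroup G] (g : G) : Subgroup G :=
  (Subgroup.zpowers g).topologicalClosure

/-- The set `π(g)` of prime divisors of the order of the procyclic subgroup generated by `g`. -/
def elementPrimes [TopologicalSpace G] [IsTopologicalGroup G] (g : G) : Set Nat.Primes :=
  primeDivisors (procyclic g)

/-- The commutator `[x, y] = x⁻¹ y⁻¹ x y`. -/
def comm (x y : G) : G := x⁻¹ * y⁻¹ * x * y

/-- The left-normed commutator `[x₁, …, x_k] = [[x₁, …, x_{k-1}], x_k]`, with `[x₁] = x₁`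
(and the dummy value `1` for `k = 0`). -/
def leftNormed : (k : ℕ) → (Fin k → G) → G
  | 0, _ => 1
  | 1, x => x 0
  | k + 2, x => comm (leftNormed (k + 1) (Fin.init x)) (x (Fin.last (k + 1)))

/-- The set `𝒰_k(G)` of uniform `k`-step commutators. -/
def uniformCommutators (G : Type*) [Group G] [TopologicalSpace G] [IsTopologicalGroup G]
    (k : ℕ) : Set G :=
  {g | ∃ x : Fin k → G, (∀ i j, elementPrimes (x i) = elementPrimes (x j)) ∧ g = leftNormed k x}

/-- The `k`-th term (`k ≥ 1`) of the lower central series, `γ₁(G) = G`, as a closed subgroup of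
the topological group `G`. Mathlib's lower central series is indexed from `0`. -/
def gammaSubgroup (G : Type*) [Group G] [TopologicalSpace G] [IsTopologicalGroup G]
    (k : ℕ) : Subgroup G :=
  ((⊤ : Subgroup G).lowerCentralSeries (k - 1)).topologicalClosure

end UniformComm

/-!
In a finite group, write `[g, x] = (g⁻¹ x⁻¹ g) x`. The trailing factor `x` does not matter up to
conjugation, so every Engel commutator `[g, x, …, x]` of length `k` is conjugate to
`[g⁻¹ x⁻¹ g, x, …, x]`, a uniform commutator because its entries have the same order.

Suppose that the uniform commutators commute with each other, and let `A` be the abelian normal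
subgroup they generate. For `h ∈ A` we have `[h ^ j, x, …, x] = [h, x, …, x] ^ j`, so all powers
of a long Engel commutator are uniform commutators. There are at most `m` elements with this
property, each of order at most `m`, so they generate a normal subgroup of order at most `m ^ m`.
If the only such element is `1`, the group is Engel, hence nilpotent by Zorn's theorem. In a
nilpotent group every commutator of `k` elements is uniform, as is seen in the Sylow subgroups, so
all powers of a central one are uniform and `γ_k` is trivial. Otherwise factor out the normal
subgroup: uniform commutators lift from quotients, so the quotient has fewer of them, and
induction bounds the order of `γ_k`.

In general the group acts on its `m` uniform commutators by conjugation, so the subgroup they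
generate has a center of index at most `m!`. Schur's theorem bounds its commutator subgroup,
modulo which the previous case applies. A profinite group reduces to its finite quotients because,
by compactness, an element of a finite quotient lifts to one with the same set of primes.
-/

namespace UniformComm

open Subgroup
open scoped commutatorElement

section Commutators

variable {G H : Type*} [Group G] [Group H]

theorem comm_eq_commutatorElement (x y : G) : comm x y = ⁅x⁻¹, y⁻¹⁆ := by
  simp [comm, commutatorElement_def]

theorem comm_eq_inv_mul_conj (x y : G) : comm x y = x⁻¹ * (y⁻¹ * x * y) := by
  simp [comm, mul_assoc]

theorem comm_mul_right (w x y : G) : comm w (x * y) = comm w y * (y⁻¹ * comm w x * y) := by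
  simp only [comm]
  group

theorem comm_pow_left_of_commute {h x : G} (hc : Commute h (x⁻¹ * h * x)) (j : ℕ) :
    comm (h ^ j) x = comm h x ^ j := by
  have conj_pow_eq : x⁻¹ * h ^ j * x = (x⁻¹ * h * x) ^ j := by
    simpa using (conj_pow (i := j) (a := x⁻¹) (b := h)).symm
  rw [comm_eq_inv_mul_conj, comm_eq_inv_mul_conj, conj_pow_eq, hc.inv_left.mul_pow, inv_pow]

theorem comm_pow_right_of_mem_center {w x : G} (h : comm w x ∈ center G) (j : ℕ) :
    comm w (x ^ j) = comm w x ^ j := by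
  induction j with
  | zero => simp [comm]
  | succ j ih =>
    have hcentral : comm w x ^ j * x = x * comm w x ^ j := (mem_center_iff.1 (pow_mem h j) x).symm
    rw [pow_succ, comm_mul_right, ih, mul_assoc x⁻¹, hcentral, inv_mul_cancel_left, ← pow_succ']

theorem map_comm (f : G →* H) (x y : G) : f (comm x y) = comm (f x) (f y) := by
  simp [comm]

theorem map_leftNormed (f : G →* H) : ∀ (k : ℕ) (x : Fin k → G),
    f (leftNormed k x) = leftNormed k (f ∘ x)
  | 0, _ => by simp [leftNormed]
  | 1, _ => rfl
  | k + 2, x => by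
    simp only [leftNormed, map_comm, map_leftNormed f (k + 1)]
    rfl

theorem leftNormed_snoc (k : ℕ) (x : Fin (k + 1) → G) (y : G) :
    leftNormed (k + 2) (Fin.snoc (α := fun _ => G) x y) = comm (leftNormed (k + 1) x) y := by
  simp [leftNormed]

theorem leftNormed_eq_one : ∀ {k : ℕ} {x : Fin k → G} (i : Fin k), x i = 1 → leftNormed k x = 1
  | 0, _, i, _ => i.elim0
  | 1, x, i, h => by rwa [Subsingleton.elim i 0] at h
  | k + 2, x, i, h => by
    cases i using Fin.lastCases with
    | last => simp [leftNormed, comm, h]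
    | cast i => simp [leftNormed, comm, leftNormed_eq_one (x := Fin.init x) i h]

theorem leftNormed_one (k : ℕ) : leftNormed k (1 : Fin k → G) = 1 := by
  simpa using (map_leftNormed (1 : G →* G) k 1).symm

theorem leftNormed_update_last_pow {n : ℕ} {x : Fin (n + 1) → G}
    (h : leftNormed (n + 1) x ∈ center G) (j : ℕ) :
    leftNormed (n + 1) (Function.update x (Fin.last n) (x (Fin.last n) ^ j)) =
      leftNormed (n + 1) x ^ j := by
  cases n with
  | zero => simp [leftNormed]
  | succ n => simpa [leftNormed] using comm_pow_right_of_mem_center h j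

/-- The Engel commutator `[g, x, …, x]`, with `n` occurrences of `x`. -/
def engelCommutator (g x : G) (n : ℕ) : G :=
  (fun a => comm a x)^[n] g

theorem engelCommutator_succ (g x : G) (n : ℕ) :
    engelCommutator g x (n + 1) = comm (engelCommutator g x n) x :=
  Function.iterate_succ_apply' _ n g

theorem engelCommutator_succ' (g x : G) (n : ℕ) :
    engelCommutator g x (n + 1) = engelCommutator (comm g x) x n :=
  Function.iterate_succ_apply _ n g

theorem engelCommutator_add (g x : G) (m n : ℕ) :
    engelCommutator g x (m + n) = engelCommutator (engelCommutator g x n) x m :=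
  Function.iterate_add_apply _ m n g

theorem engelCommutator_conj (g x : G) (n : ℕ) :
    engelCommutator (x⁻¹ * g * x) x n = x⁻¹ * engelCommutator g x n * x := by
  induction n with
  | zero => rfl
  | succ n ih =>
    rw [engelCommutator_succ, engelCommutator_succ, ih]
    simp only [comm]
    group

theorem engelCommutator_mul_self (g x : G) (n : ℕ) :
    engelCommutator (g * x) x (n + 1) = x⁻¹ * engelCommutator g x (n + 1) * x := by
  have comm_mul_self : comm (g * x) x = x⁻¹ * comm g x * x := by
    simp only [comm]
    group
  rw [engelCommutator_succ', comm_mul_self, engelCommutator_conj, engelCommutator_succ']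

theorem leftNormed_cons_const (g x : G) (n : ℕ) :
    leftNormed (n + 1) (Fin.cons g fun _ => x) = engelCommutator g x n := by
  induction n with
  | zero => rfl
  | succ n ih =>
    have snoc_eq : (Fin.cons g fun _ => x : Fin (n + 2) → G) =
        Fin.snoc (α := fun _ => G) (Fin.cons g fun _ => x) x := by
      rw [← Fin.cons_snoc_eq_snoc_cons]
      congr 1
      funext i
      cases i using Fin.lastCases <;> simp
    rw [snoc_eq, leftNormed_snoc, ih, engelCommutator_succ]

theorem engelCommutator_mem {N : Subgroup G} {g x : G} (hg : g ∈ N) (hx : x ∈ N) (n : ℕ) :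
    engelCommutator g x n ∈ N := by
  induction n with
  | zero => exact hg
  | succ n ih =>
    rw [engelCommutator_succ]
    exact mul_mem (mul_mem (mul_mem (inv_mem ih) (inv_mem hx)) ih) hx

theorem engelCommutator_pow_of_isMulCommutative {A : Subgroup G} [A.Normal] [IsMulCommutative A]
    {h : G} (hA : h ∈ A) (x : G) (j n : ℕ) :
    engelCommutator (h ^ j) x n = engelCommutator h x n ^ j := by
  induction n generalizing h with
  | zero => rfl
  | succ n ih =>
    have conj_mem : x⁻¹ * h * x ∈ A := Normal.conj_mem' inferInstance h hA x
    have hcomm : Commute h (x⁻¹ * h * x) :=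
      congrArg Subtype.val (mul_comm' (⟨h, hA⟩ : A) ⟨_, conj_mem⟩)
    rw [engelCommutator_succ', engelCommutator_succ', comm_pow_left_of_commute hcomm]
    refine ih ?_
    rw [comm_eq_inv_mul_conj]
    exact mul_mem (inv_mem hA) conj_mem

end Commutators

section LowerCentralSeries

variable {G : Type*} [Group G]

theorem normal_closure_image2_comm (V : Set G) :
    (closure (Set.image2 comm V Set.univ)).Normal := by
  rw [← normalizer_eq_top_iff, ← top_le_iff, le_normalizer_closure_iff]
  rintro g - _ ⟨v, hv, x, -, rfl⟩
  have comm_mem (y : G) : comm v y ∈ closure (Set.image2 comm V Set.univ) :=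
    subset_closure ⟨v, hv, y, trivial, rfl⟩
  have conj_eq : g * comm v x * g⁻¹ = (comm v g⁻¹)⁻¹ * comm v (x * g⁻¹) := by
    rw [comm_mul_right, inv_mul_cancel_left, inv_inv]
  exact conj_eq ▸ mul_mem (inv_mem (comm_mem _)) (comm_mem _)

theorem commutator_closure_top (V : Set G) :
    ⁅closure V, (⊤ : Subgroup G)⁆ = closure (Set.image2 comm V Set.univ) := by
  have := normal_closure_image2_comm V
  apply le_antisymm
  · let π := QuotientGroup.mk' (closure (Set.image2 comm V Set.univ))
    have map_comm_eq_one {v : G} (hv : v ∈ V) (x : G) : ⁅π v⁻¹, π x⁻¹⁆ = 1 := by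
      rw [← map_commutatorElement, ← comm_eq_commutatorElement]
      exact (QuotientGroup.eq_one_iff _).2 (subset_closure ⟨v, hv, x, trivial, rfl⟩)
    have closure_le_comap_center : closure V ≤ (center _).comap π := by
      refine (closure_le _).2 fun v hv => inv_mem_iff.1 (mem_center_iff.2 fun y => ?_)
      obtain ⟨x, rfl⟩ := QuotientGroup.mk'_surjective _ y
      have := commutatorElement_eq_one_iff_commute.1 (map_comm_eq_one hv x⁻¹)
      rw [inv_inv, map_inv] at this
      exact this.eq.symm
    rw [commutator_le]
    intro g hg x _
    have hgx : Commute (π g) (π x) := (mem_center_iff.1 (closure_le_comap_center hg) (π x)).symm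
    rw [← QuotientGroup.eq_one_iff]
    exact (map_commutatorElement π g x).trans (commutatorElement_eq_one_iff_commute.2 hgx)
  · rw [closure_le]
    rintro _ ⟨v, hv, x, -, rfl⟩
    rw [comm_eq_commutatorElement]
    exact commutator_mem_commutator (inv_mem (subset_closure hv)) (mem_top _)

theorem lowerCentralSeries_add_eq_closure_leftNormed (j n : ℕ) :
    (⊤ : Subgroup G).lowerCentralSeries (j + n) =
      closure (leftNormed (n + 1) '' {x | x 0 ∈ (⊤ : Subgroup G).lowerCentralSeries j}) := by
  induction n with
  | zero =>
    have image_eq : leftNormed 1 '' {x | x 0 ∈ (⊤ : Subgroup G).lowerCentralSeries j} =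
        (⊤ : Subgroup G).lowerCentralSeries j :=
      Set.Subset.antisymm (Set.image_subset_iff.2 fun x hx => hx) fun y hy => ⟨fun _ => y, hy, rfl⟩
    rw [image_eq, closure_eq, add_zero]
  | succ n ih =>
    rw [← add_assoc, Subgroup.lowerCentralSeries_succ, ih, commutator_closure_top]
    congr 1
    apply Set.Subset.antisymm
    · rintro _ ⟨_, ⟨x, hx, rfl⟩, y, -, rfl⟩
      exact ⟨Fin.snoc (α := fun _ => G) x y, by simpa [Fin.snoc] using hx, leftNormed_snoc n x y⟩
    · rintro _ ⟨x, hx, rfl⟩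
      exact ⟨_, ⟨Fin.init x, hx, rfl⟩, x (Fin.last _), trivial, rfl⟩

end LowerCentralSeries

section Engel

variable {G : Type*} [Group G]

theorem exists_mem_normalizer_of_lt {D K : Subgroup G} [Group.IsNilpotent K] (h : D < K) :
    ∃ x ∈ K, x ∉ D ∧ x ∈ normalizer (D : Set G) := by
  have subgroupOf_lt : D.subgroupOf K < ⊤ :=
    lt_top_iff_ne_top.2 fun e => h.not_ge (subgroupOf_eq_top.1 e)
  obtain ⟨x, hx, hxD⟩ :=
    SetLike.exists_of_lt (Group.normalizerCondition_of_isNilpotent _ subgroupOf_lt)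
  rw [← subgroupOf_normalizer_eq h.le] at hx
  exact ⟨x, x.2, hxD ∘ mem_subgroupOf.2, mem_subgroupOf.1 hx⟩

variable {p : ℕ}

theorem mem_inv_smul_sylow_iff {P : Sylow p G} {z g : G} :
    g ∈ (z⁻¹ • P : Sylow p G) ↔ z * g * z⁻¹ ∈ P := by
  rw [← SetLike.mem_coe, Sylow.coe_smul, Set.mem_smul_set_iff_inv_smul_mem]
  simp

variable [Finite G]

theorem exists_sylow_ne_inf_lt_inf [Fact p.Prime]
    (hG : ∀ g x : G, ∃ n, engelCommutator g x n = 1) {P Q : Sylow p G} (hQP : Q ≠ P) :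
    ∃ R : Sylow p G, R ≠ P ∧ (P : Subgroup G) ⊓ Q < (P : Subgroup G) ⊓ R := by
  have inf_lt_left : (P : Subgroup G) ⊓ Q < P :=
    inf_lt_left.2 fun h => hQP (Sylow.ext (P.is_maximal' Q.isPGroup' h))
  have inf_lt_right : (P : Subgroup G) ⊓ Q < Q :=
    inf_lt_right.2 fun h => hQP (Sylow.ext (Q.is_maximal' P.isPGroup' h).symm)
  have := P.isPGroup'.isNilpotent
  have := Q.isPGroup'.isNilpotent
  obtain ⟨x, hxP, hxD, hxN⟩ := exists_mem_normalizer_of_lt inf_lt_left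
  obtain ⟨y, hyQ, hyD, hyN⟩ := exists_mem_normalizer_of_lt inf_lt_right
  -- The last Engel commutator `z = [y, x, …, x]` outside the normalizer of `P` conjugates `x` into
  -- `P` while it normalizes `P ⊓ Q`, so `z⁻¹ • P` meets `P` in a subgroup larger than `P ⊓ Q`.
  have hyP : y ∉ normalizer (P : Set G) := fun h =>
    hyD ⟨(Q.isPGroup'.inf_normalizer_sylow P).le ⟨hyQ, h⟩ |>.2, hyQ⟩
  obtain ⟨n, hn, hn'⟩ : ∃ n, engelCommutator y x n ∉ normalizer (P : Set G) ∧
      engelCommutator y x (n + 1) ∈ normalizer (P : Set G) := by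
    obtain ⟨N, hN⟩ := hG y x
    exact Nat.exists_not_and_succ_of_not_zero_of_exists hyP ⟨N, hN ▸ one_mem _⟩
  set z := engelCommutator y x n
  have hzN : z ∈ normalizer (((P : Subgroup G) ⊓ Q : Subgroup G) : Set G) :=
    engelCommutator_mem hyN hxN n
  have conj_mem_smul : z⁻¹ * x * z ∈ (z⁻¹ • P : Sylow p G) := by
    rw [mem_inv_smul_sylow_iff, mul_assoc z⁻¹, mul_inv_cancel_left, mul_inv_cancel_right]
    exact hxP
  have conj_mem_normalizer : z⁻¹ * x * z ∈ normalizer (P : Set G) := by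
    have conj_eq : z⁻¹ * x * z = x * (comm z x)⁻¹ := by
      simp only [comm]
      group
    rw [conj_eq]
    exact mul_mem (le_normalizer hxP) (inv_mem (engelCommutator_succ y x n ▸ hn'))
  have conj_mem : z⁻¹ * x * z ∈ P :=
    ((z⁻¹ • P).isPGroup'.inf_normalizer_sylow P).le ⟨conj_mem_smul, conj_mem_normalizer⟩ |>.2
  refine ⟨z⁻¹ • P, fun h => hn (inv_mem_iff.1 (Sylow.smul_eq_iff_mem_normalizer.1 h)), ?_⟩
  refine SetLike.lt_iff_le_and_exists.2 ⟨fun d hd => ⟨hd.1, ?_⟩, z⁻¹ * x * z, ?_, ?_⟩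
  · exact mem_inv_smul_sylow_iff.2 ((mem_normalizer_iff.1 hzN d).1 hd).1
  · exact ⟨conj_mem, conj_mem_smul⟩
  · exact (mem_normalizer_iff''.1 hzN x).not.1 hxD

theorem sylow_normal_of_engel [Fact p.Prime]
    (hG : ∀ g x : G, ∃ n, engelCommutator g x n = 1) (P : Sylow p G) : (P : Subgroup G).Normal := by
  suffices ∀ Q : Sylow p G, Q = P by
    have : Subsingleton (Sylow p G) := ⟨fun Q R => (this Q).trans (this R).symm⟩
    exact P.normal_of_subsingleton
  by_contra! hne
  obtain ⟨Q, hQ, hmax⟩ := Set.exists_max_image {Q : Sylow p G | Q ≠ P}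
    (fun Q => Nat.card ((P : Subgroup G) ⊓ Q : Subgroup G)) (Set.toFinite _) hne
  obtain ⟨R, hR, hlt⟩ := exists_sylow_ne_inf_lt_inf hG hQ
  exact hlt.ne (eq_of_le_of_card_ge hlt.le (hmax R hR))

/-- This is Zorn's theorem on Engel groups. -/
theorem isNilpotent_of_engel (hG : ∀ g x : G, ∃ n, engelCommutator g x n = 1) :
    Group.IsNilpotent G := by
  refine (Group.isNilpotent_of_finite_tfae.out 0 3 :
    _ ↔ ∀ p, Fact p.Prime → ∀ P : Sylow p G, (P : Subgroup G).Normal).2 ?_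
  exact fun p _ P => sylow_normal_of_engel hG P

end Engel

section FiniteUniform

variable {G H : Type*} [Group G] [Group H]

theorem exists_lift_primeFactors_orderOf (f : G →* H) {x : G} (hx : IsOfFinOrder x) :
    ∃ y : G, f y = f x ∧ (orderOf y).primeFactors = (orderOf (f x)).primeFactors := by
  obtain ⟨y, ⟨hyx, hy⟩, hmin⟩ := exists_minimalFor_of_wellFoundedLT
    (fun y => f y = f x ∧ IsOfFinOrder y) orderOf ⟨x, rfl, hx⟩
  refine ⟨y, hyx, Finset.Subset.antisymm (fun p hp => ?_) ?_⟩
  · have p_prime := Nat.prime_of_mem_primeFactors hp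
    by_contra hpx
    -- Otherwise some power of `y ^ p` also lifts `f x`, and it has smaller order than `y`.
    have p_coprime : p.Coprime (orderOf (f y)) := p_prime.coprime_iff_not_dvd.2 fun hpy =>
      hpx (Nat.mem_primeFactors.2 ⟨p_prime, hyx ▸ hpy, hyx ▸ (f.isOfFinOrder hy).orderOf_pos.ne'⟩)
    obtain ⟨m, hm⟩ := exists_pow_eq_self_of_coprime p_coprime
    have orderOf_lt : orderOf ((y ^ p) ^ m) < orderOf y :=
      calc orderOf ((y ^ p) ^ m) ≤ orderOf (y ^ p) :=
            Nat.le_of_dvd hy.pow.orderOf_pos (orderOf_pow_dvd m)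
        _ = orderOf y / p := orderOf_pow_of_dvd p_prime.ne_zero (Nat.dvd_of_mem_primeFactors hp)
        _ < orderOf y := Nat.div_lt_self hy.orderOf_pos p_prime.one_lt
    exact orderOf_lt.not_ge (hmin ⟨by simpa [hyx] using hm, hy.pow.pow⟩ orderOf_lt.le)
  · exact hyx ▸ Nat.primeFactors_mono (orderOf_map_dvd f y) hy.orderOf_pos.ne'

/-- The `k`-step commutators of elements whose orders have the same prime divisors: the
analogue of `uniformCommutators` for finite groups without a topology. -/
def finiteUniformCommutators (G : Type*) [Group G] (k : ℕ) : Set G :=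
  leftNormed k '' {x | ∀ i j, (orderOf (x i)).primeFactors = (orderOf (x j)).primeFactors}

theorem one_mem_finiteUniformCommutators (k : ℕ) : (1 : G) ∈ finiteUniformCommutators G k :=
  ⟨1, fun _ _ => rfl, leftNormed_one k⟩

theorem finiteUniformCommutators_one : finiteUniformCommutators G 1 = Set.univ :=
  Set.eq_univ_of_forall fun g =>
    ⟨fun _ => g, fun _ _ => rfl, rfl⟩

theorem map_mem_finiteUniformCommutators {k : ℕ} {f : G →* H} (hf : Function.Injective f) {u : G}
    (hu : u ∈ finiteUniformCommutators G k) : f u ∈ finiteUniformCommutators H k := by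
  obtain ⟨x, hx, rfl⟩ := hu
  refine ⟨f ∘ x, fun i j => ?_, (map_leftNormed f k x).symm⟩
  simp only [Function.comp_apply, orderOf_injective f hf, hx i j]

theorem conj_mem_finiteUniformCommutators {k : ℕ} {u : G} (hu : u ∈ finiteUniformCommutators G k)
    (g : G) : g * u * g⁻¹ ∈ finiteUniformCommutators G k :=
  map_mem_finiteUniformCommutators (f := (MulAut.conj g).toMonoidHom) (MulAut.conj g).injective hu

theorem engelCommutator_mem_finiteUniformCommutators (g x : G) (n : ℕ) :
    engelCommutator g x (n + 1) ∈ finiteUniformCommutators G (n + 1) := by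
  cases n with
  | zero => simp [finiteUniformCommutators_one]
  | succ n =>
    -- `[g, x] = (g⁻¹ x⁻¹ g) x`, and the trailing factor `x` can be dropped up to conjugation, so
    -- `[g, x, …, x]` is conjugate to a commutator of elements of the same order.
    have engel_eq : engelCommutator g x (n + 2) =
        x⁻¹ * engelCommutator (g⁻¹ * x⁻¹ * g) x (n + 1) * x⁻¹⁻¹ := by
      rw [inv_inv, ← engelCommutator_mul_self, engelCommutator_succ']
      rfl
    have orderOf_conj : orderOf (g⁻¹ * x⁻¹ * g) = orderOf x := by
      simpa using MulEquiv.orderOf_eq (MulAut.conj g⁻¹) x⁻¹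
    have orderOf_cons (i : Fin (n + 2)) :
        orderOf ((Fin.cons (g⁻¹ * x⁻¹ * g) fun _ => x : Fin (n + 2) → G) i) = orderOf x := by
      cases i using Fin.cases <;> simp [orderOf_conj]
    rw [engel_eq, ← leftNormed_cons_const]
    refine conj_mem_finiteUniformCommutators ⟨_, fun i j => ?_, rfl⟩ x⁻¹
    rw [orderOf_cons, orderOf_cons]

theorem image_finiteUniformCommutators_superset (hG : IsMulTorsion G) {f : G →* H}
    (hf : Function.Surjective f) (k : ℕ) :
    finiteUniformCommutators H k ⊆ f '' finiteUniformCommutators G k := by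
  rintro _ ⟨x, hx, rfl⟩
  have exists_lift (i : Fin k) :
      ∃ y : G, f y = x i ∧ (orderOf y).primeFactors = (orderOf (x i)).primeFactors := by
    obtain ⟨z, hz⟩ := hf (x i)
    exact hz ▸ exists_lift_primeFactors_orderOf f (hG z)
  choose y hyx hy using exists_lift
  refine ⟨leftNormed k y, ⟨y, fun i j => by rw [hy, hy, hx i j], rfl⟩, ?_⟩
  rw [map_leftNormed, show f ∘ y = x from funext hyx]

theorem primeFactors_orderOf_pi {ι : Type*} [Fintype ι] {A : ι → Type*} [∀ i, Group (A i)]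
    {z : ∀ i, A i} (hz : IsOfFinOrder z) :
    (orderOf z).primeFactors = Finset.univ.biUnion fun i => (orderOf (z i)).primeFactors := by
  ext p
  simp only [Finset.mem_biUnion, Finset.mem_univ, true_and]
  constructor
  · intro hp
    have p_prime := Nat.prime_of_mem_primeFactors hp
    have p_dvd_prod : p ∣ ∏ i, orderOf (z i) :=
      (Nat.dvd_of_mem_primeFactors hp).trans (Pi.orderOf z ▸ Finset.lcm_dvd_prod _ _)
    obtain ⟨i, -, hi⟩ := (p_prime.prime.dvd_finsetProd_iff _).1 p_dvd_prod
    exact ⟨i, Nat.mem_primeFactors.2 ⟨p_prime, hi, (hz.apply i).orderOf_pos.ne'⟩⟩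
  · rintro ⟨i, hi⟩
    exact Nat.primeFactors_mono (orderOf_map_dvd (Pi.evalMonoidHom A i) z) hz.orderOf_pos.ne' hi

theorem leftNormed_mem_finiteUniformCommutators_pi {ι : Type*} [Finite ι] {A : ι → Type*}
    [∀ i, Group (A i)] [∀ i, Finite (A i)] {k : ℕ} {x : Fin k → ∀ i, A i}
    (hx : ∀ i, leftNormed k (fun j => x j i) ∈ finiteUniformCommutators (A i) k) :
    leftNormed k x ∈ finiteUniformCommutators (∀ i, A i) k := by
  have := Fintype.ofFinite ι
  have leftNormed_apply (i : ι) (w : Fin k → ∀ i, A i) :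
      leftNormed k w i = leftNormed k (fun j => w j i) :=
    map_leftNormed (Pi.evalMonoidHom A i) k w
  choose y hy hyx using hx
  refine ⟨fun j i => y i j, fun j l => ?_, funext fun i => ?_⟩
  · have isOfFinOrder (j : Fin k) : IsOfFinOrder fun i => y i j := isOfFinOrder_of_finite _
    simp only [primeFactors_orderOf_pi (isOfFinOrder _), hy _ j l]
  · rw [leftNormed_apply, leftNormed_apply, ← hyx]

theorem leftNormed_mem_finiteUniformCommutators_of_isPGroup {p : ℕ} [Fact p.Prime]
    (hG : IsPGroup p G) {k : ℕ} (x : Fin k → G) :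
    leftNormed k x ∈ finiteUniformCommutators G k := by
  by_cases hx : ∃ i, x i = 1
  · obtain ⟨i, hi⟩ := hx
    exact leftNormed_eq_one i hi ▸ one_mem_finiteUniformCommutators k
  · push Not at hx
    have primeFactors_eq (i : Fin k) : (orderOf (x i)).primeFactors = {p} := by
      obtain ⟨n, hn⟩ := IsPGroup.iff_orderOf.1 hG (x i)
      have n_ne_zero : n ≠ 0 := by
        rintro rfl
        exact hx i (orderOf_eq_one_iff.1 (by simpa using hn))
      rw [hn, Nat.primeFactors_prime_pow n_ne_zero Fact.out]
    exact ⟨x, fun i j => by rw [primeFactors_eq, primeFactors_eq], rfl⟩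

theorem leftNormed_mem_finiteUniformCommutators_of_isNilpotent [Finite G] [hG : Group.IsNilpotent G]
    {k : ℕ} (x : Fin k → G) : leftNormed k x ∈ finiteUniformCommutators G k := by
  obtain ⟨e⟩ := (Group.isNilpotent_of_finite_tfae.out 0 4).1 hG
  have mem_pi : leftNormed k (e.symm ∘ x) ∈ finiteUniformCommutators _ k :=
    leftNormed_mem_finiteUniformCommutators_pi fun p =>
      leftNormed_mem_finiteUniformCommutators_pi fun P =>
        have := Fact.mk (Nat.prime_of_mem_primeFactors p.2)
        leftNormed_mem_finiteUniformCommutators_of_isPGroup P.isPGroup' _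
  have map_mem := map_mem_finiteUniformCommutators (f := e.toMonoidHom) e.injective mem_pi
  rw [map_leftNormed] at map_mem
  simpa [Function.comp_def] using map_mem

end FiniteUniform

section Bounds

variable {G H : Type*} [Group G] [Group H]

theorem card_closure_le_pow [Finite G] {S : Set G} {m : ℕ}
    (hcomm : ∀ a ∈ S, ∀ b ∈ S, Commute a b) (hord : ∀ a ∈ S, orderOf a ≤ m) :
    Nat.card (closure S) ≤ m ^ S.ncard := by
  have := Fintype.ofFinite S
  have zpowers_commute : Pairwise fun i j : S => ∀ x y : G, x ∈ zpowers (i : G) →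
      y ∈ zpowers (j : G) → Commute x y := by
    rintro i j - _ _ ⟨a, rfl⟩ ⟨b, rfl⟩
    exact ((hcomm i i.2 j j.2).zpow_left a).zpow_right b
  have closure_le_range : closure S ≤ (noncommPiCoprod zpowers_commute).range := by
    rw [noncommPiCoprod_range, closure_le]
    exact fun s hs => mem_iSup_of_mem (⟨s, hs⟩ : S) (mem_zpowers s)
  calc Nat.card (closure S) ≤ Nat.card (noncommPiCoprod zpowers_commute).range :=
        card_le_of_le closure_le_range
    _ ≤ Nat.card (∀ i : S, zpowers (i : G)) :=
        Nat.card_le_card_of_surjective _ (MonoidHom.rangeRestrict_surjective _)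
    _ = ∏ i : S, orderOf (i : G) := by
        simp only [Nat.card_pi, Nat.card_zpowers]
    _ ≤ ∏ _i : S, m := Finset.prod_le_prod' fun i _ => hord i i.2
    _ = m ^ S.ncard := by
        rw [Finset.prod_const, Finset.card_univ, ← Nat.card_eq_fintype_card, Nat.card_coe_set_eq]

theorem card_le_card_ker_mul_card_map (f : G →* H) [Finite f.ker] (L : Subgroup G) :
    Nat.card L ≤ Nat.card f.ker * Nat.card (L.map f) := by
  rw [← card_mul_index (f.ker.subgroupOf L), ← relIndex_ker L f]
  refine Nat.mul_le_mul_right _ (Nat.card_le_card_of_injective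
    (fun x : f.ker.subgroupOf L => (⟨x.1.1, x.2⟩ : f.ker)) fun x y hxy => ?_)
  exact Subtype.ext (Subtype.ext (congrArg (fun z : f.ker => (z : G)) hxy))

theorem card_lowerCentralSeries_le_mul_quotient (N : Subgroup G) [N.Normal] [Finite N] (n : ℕ) :
    Nat.card ((⊤ : Subgroup G).lowerCentralSeries n) ≤
      Nat.card N * Nat.card ((⊤ : Subgroup (G ⧸ N)).lowerCentralSeries n) := by
  have map_eq : ((⊤ : Subgroup G).lowerCentralSeries n).map (QuotientGroup.mk' N) =
      (⊤ : Subgroup (G ⧸ N)).lowerCentralSeries n := by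
    rw [map_lowerCentralSeries, map_top_of_surjective _ (QuotientGroup.mk'_surjective N)]
  have : Finite (QuotientGroup.mk' N).ker := by rwa [QuotientGroup.ker_mk']
  simpa only [map_eq, QuotientGroup.ker_mk'] using
    card_le_card_ker_mul_card_map (QuotientGroup.mk' N) ((⊤ : Subgroup G).lowerCentralSeries n)

theorem normal_closure_of_conj_mem {S : Set G} (hS : ∀ s ∈ S, ∀ g : G, g * s * g⁻¹ ∈ S) :
    (closure S).Normal := by
  rw [← normalizer_eq_top_iff, eq_top_iff, le_normalizer_closure_iff]
  exact fun g _ s hs => subset_closure (hS s hs g)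

theorem index_centralizer_dvd_factorial {U : Set G} (hU : U.Finite)
    (hconj : ∀ u ∈ U, ∀ g : G, g * u * g⁻¹ ∈ U) : (centralizer U).index ∣ U.ncard.factorial := by
  let conjAction : MulAction G U :=
    { smul g u := ⟨g * u * g⁻¹, hconj u u.2 g⟩
      one_smul u := Subtype.ext (by simp [HSMul.hSMul])
      mul_smul g h u := Subtype.ext (by simp [HSMul.hSMul, mul_assoc]) }
  have := hU.to_subtype
  have ker_eq : (MulAction.toPermHom G U).ker = centralizer U := by
    ext g
    simp only [MonoidHom.mem_ker, mem_centralizer_iff, Equiv.ext_iff, Subtype.forall,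
      Subtype.ext_iff]
    exact forall₂_congr fun u _ => mul_inv_eq_iff_eq_mul.trans eq_comm
  rw [← ker_eq, index_ker, ← Nat.card_coe_set_eq, ← Nat.card_perm]
  exact card_subgroup_dvd_card _

theorem card_commutatorSet_le_index_center_sq [(center G).FiniteIndex] :
    Nat.card (commutatorSet G) ≤ (center G).index ^ 2 := by
  have commutator_mul_center (a b : G) {z w : G} (hz : z ∈ center G) (hw : w ∈ center G) :
      ⁅a * z, b * w⁆ = ⁅a, b⁆ := by
    have commutator_left_eq_one (g : G) : ⁅z, g⁆ = 1 :=
      commutatorElement_eq_one_iff_commute.2 (mem_center_iff.1 hz g).symm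
    have commutator_right_eq_one (g : G) : ⁅g, w⁆ = 1 :=
      commutatorElement_eq_one_iff_commute.2 (mem_center_iff.1 hw g)
    simp only [commutatorElement_mul_left_eq_conj_mul, commutatorElement_mul_right_eq_mul_conj,
      commutator_left_eq_one, commutator_right_eq_one, mul_one, one_mul, mul_inv_cancel,
      mul_inv_cancel_right]
  let commutatorOfOut (q : (G ⧸ center G) × (G ⧸ center G)) : commutatorSet G :=
    ⟨⁅q.1.out, q.2.out⁆, commutator_mem_commutatorSet _ _⟩
  have surjective : Function.Surjective commutatorOfOut := by
    rintro ⟨_, a, b, rfl⟩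
    obtain ⟨z, hz⟩ := QuotientGroup.mk_out_eq_mul (center G) a
    obtain ⟨w, hw⟩ := QuotientGroup.mk_out_eq_mul (center G) b
    refine ⟨(a, b), Subtype.ext ?_⟩
    simp only [commutatorOfOut, hz, hw, commutator_mul_center a b z.2 w.2]
  calc Nat.card (commutatorSet G) ≤ Nat.card ((G ⧸ center G) × (G ⧸ center G)) :=
        Nat.card_le_card_of_surjective _ surjective
    _ = (center G).index ^ 2 := by rw [Nat.card_prod, ← index_eq_card, sq]

theorem card_commutator_le_index_center_pow [(center G).FiniteIndex] [Finite (commutatorSet G)] :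
    Nat.card (commutator G) ≤ (center G).index ^ ((center G).index ^ 3 + 1) := by
  have index_pos : 0 < (center G).index := Nat.pos_of_ne_zero FiniteIndex.index_ne_zero
  refine (Nat.le_of_dvd (pow_pos index_pos _) (card_commutator_dvd_index_center_pow G)).trans
    (Nat.pow_le_pow_right index_pos (Nat.succ_le_succ ?_))
  rw [pow_succ']
  exact Nat.mul_le_mul_left _ card_commutatorSet_le_index_center_sq

theorem card_commutator_closure_le [Finite G] {U : Set G}
    (hconj : ∀ u ∈ U, ∀ g : G, g * u * g⁻¹ ∈ U) :
    Nat.card (⁅closure U, closure U⁆ : Subgroup G) ≤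
      U.ncard.factorial ^ (U.ncard.factorial ^ 3 + 1) := by
  have subgroupOf_le_center : (centralizer U).subgroupOf (closure U) ≤ center (closure U) := by
    intro x hx
    exact mem_center_iff.2 fun y => Subtype.ext
      (mem_centralizer_iff.1 (closure_le_centralizer_centralizer U y.2) x hx).symm
  have index_center_le : (center (closure U)).index ≤ U.ncard.factorial :=
    calc (center (closure U)).index ≤ (centralizer U).relIndex (closure U) :=
          index_antitone subgroupOf_le_center
      _ ≤ (centralizer U).relIndex ⊤ := relIndex_le_of_le_right le_top index_ne_zero_of_finite
      _ = (centralizer U).index := relIndex_top_right _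
      _ ≤ U.ncard.factorial :=
          Nat.le_of_dvd (Nat.factorial_pos _) (index_centralizer_dvd_factorial U.toFinite hconj)
  calc Nat.card (⁅closure U, closure U⁆ : Subgroup G) = Nat.card (commutator (closure U)) := by
        rw [← map_subtype_commutator, card_map_of_injective (subtype_injective _)]
    _ ≤ (center (closure U)).index ^ ((center (closure U)).index ^ 3 + 1) :=
        card_commutator_le_index_center_pow
    _ ≤ U.ncard.factorial ^ (U.ncard.factorial ^ 3 + 1) :=
        pow_le_pow index_center_le (Nat.factorial_pos _) (by gcongr)

theorem ncard_finiteUniformCommutators_pos [Finite G] (k : ℕ) :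
    0 < (finiteUniformCommutators G k).ncard :=
  (Set.ncard_pos (Set.toFinite _)).2 ⟨1, one_mem_finiteUniformCommutators k⟩

theorem ncard_finiteUniformCommutators_le_of_surjective [Finite G] {f : G →* H}
    (hf : Function.Surjective f) (k : ℕ) :
    (finiteUniformCommutators H k).ncard ≤ (finiteUniformCommutators G k).ncard :=
  (Set.ncard_le_ncard (image_finiteUniformCommutators_superset isMulTorsion_of_finite hf k)
    (Set.toFinite _)).trans (Set.ncard_image_le (Set.toFinite _))

theorem ncard_finiteUniformCommutators_lt_of_surjective [Finite G] {f : G →* H}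
    (hf : Function.Surjective f) {k : ℕ} {t : G} (ht : t ∈ finiteUniformCommutators G k)
    (ht_ne : t ≠ 1) (hft : f t = 1) :
    (finiteUniformCommutators H k).ncard < (finiteUniformCommutators G k).ncard := by
  refine (Set.ncard_le_ncard (image_finiteUniformCommutators_superset isMulTorsion_of_finite hf k)
    (Set.toFinite _)).trans_lt ((Set.ncard_image_le (Set.toFinite _)).lt_of_ne fun h => ht_ne ?_)
  exact (Set.ncard_image_iff (Set.toFinite _)).1 h ht (one_mem_finiteUniformCommutators k)
    (hft.trans f.map_one.symm)

/-- The set of elements all of whose powers lie in `U`. For a finite set `U` these elements have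
order at most `|U|`. -/
def powerClosedPart (U : Set G) : Set G :=
  {t | ∀ j : ℕ, t ^ j ∈ U}

theorem powerClosedPart_subset (U : Set G) : powerClosedPart U ⊆ U :=
  fun t ht => pow_one t ▸ ht 1

theorem orderOf_le_ncard_of_mem_powerClosedPart {U : Set G} (hU : U.Finite) {t : G}
    (ht : t ∈ powerClosedPart U) : orderOf t ≤ U.ncard := by
  have powers_subset : (Submonoid.powers t : Set G) ⊆ U := by
    rintro _ ⟨j, rfl⟩
    exact ht j
  rw [← Nat.card_submonoidPowers]
  exact Set.ncard_le_ncard powers_subset hU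

theorem leftNormed_mem_powerClosedPart [Finite G] [Group.IsNilpotent G] {n : ℕ}
    {x : Fin (n + 1) → G} (hx : leftNormed (n + 1) x ∈ center G) :
    leftNormed (n + 1) x ∈ powerClosedPart (finiteUniformCommutators G (n + 1)) := fun j =>
  leftNormed_update_last_pow hx j ▸ leftNormed_mem_finiteUniformCommutators_of_isNilpotent _

theorem lowerCentralSeries_eq_bot_of_isNilpotent [Finite G] [Group.IsNilpotent G] {n : ℕ}
    (h : powerClosedPart (finiteUniformCommutators G (n + 1)) ⊆ {1}) :
    (⊤ : Subgroup G).lowerCentralSeries n = ⊥ := by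
  by_contra hne
  rw [Subgroup.lowerCentralSeries_eq_bot_iff_nilpotencyClass_le, not_le] at hne
  obtain ⟨j, hj⟩ := Nat.exists_eq_add_of_lt hne
  replace hj : Group.nilpotencyClass G = j + n + 1 := by omega
  have le_center : (⊤ : Subgroup G).lowerCentralSeries (j + n) ≤ center G := by
    rw [← commutator_top_right_eq_bot_iff_le_center, ← Subgroup.lowerCentralSeries_succ,
      Subgroup.lowerCentralSeries_eq_bot_iff_nilpotencyClass_le, hj]
  have eq_bot : (⊤ : Subgroup G).lowerCentralSeries (j + n) = ⊥ := by
    rw [lowerCentralSeries_add_eq_closure_leftNormed] at le_center ⊢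
    rw [eq_bot_iff, closure_le]
    rintro _ ⟨x, hx, rfl⟩
    exact h (leftNormed_mem_powerClosedPart (le_center (subset_closure ⟨x, hx, rfl⟩)))
  rw [Subgroup.lowerCentralSeries_eq_bot_iff_nilpotencyClass_le] at eq_bot
  omega

theorem engelCommutator_mem_powerClosedPart {n : ℕ}
    (hcomm : ∀ a ∈ finiteUniformCommutators G (n + 1), ∀ b ∈ finiteUniformCommutators G (n + 1),
      Commute a b) (g x : G) :
    engelCommutator g x (n + 1 + (n + 1)) ∈
      powerClosedPart (finiteUniformCommutators G (n + 1)) := by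
  intro j
  have := isMulCommutative_closure hcomm
  have := normal_closure_of_conj_mem fun u (hu : u ∈ finiteUniformCommutators G (n + 1)) =>
    conj_mem_finiteUniformCommutators hu
  rw [engelCommutator_add, ← engelCommutator_pow_of_isMulCommutative
    (subset_closure (engelCommutator_mem_finiteUniformCommutators g x n))]
  exact engelCommutator_mem_finiteUniformCommutators _ x n

theorem lowerCentralSeries_eq_bot_of_commute [Finite G] {n : ℕ}
    (hcomm : ∀ a ∈ finiteUniformCommutators G (n + 1), ∀ b ∈ finiteUniformCommutators G (n + 1),
      Commute a b) (h : powerClosedPart (finiteUniformCommutators G (n + 1)) ⊆ {1}) :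
    (⊤ : Subgroup G).lowerCentralSeries n = ⊥ :=
  have := isNilpotent_of_engel fun g x : G =>
    ⟨_, h (engelCommutator_mem_powerClosedPart hcomm g x)⟩
  lowerCentralSeries_eq_bot_of_isNilpotent h

theorem commute_finiteUniformCommutators_of_surjective [Finite G] {f : G →* H}
    (hf : Function.Surjective f) {k : ℕ}
    (hcomm : ∀ a ∈ finiteUniformCommutators G k, ∀ b ∈ finiteUniformCommutators G k,
      Commute (f a) (f b)) :
    ∀ a ∈ finiteUniformCommutators H k, ∀ b ∈ finiteUniformCommutators H k, Commute a b := by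
  intro a ha b hb
  obtain ⟨a', ha', rfl⟩ := image_finiteUniformCommutators_superset isMulTorsion_of_finite hf k ha
  obtain ⟨b', hb', rfl⟩ := image_finiteUniformCommutators_superset isMulTorsion_of_finite hf k hb
  exact hcomm a' ha' b' hb'

theorem conj_mem_powerClosedPart {U : Set G} (hU : ∀ u ∈ U, ∀ g : G, g * u * g⁻¹ ∈ U) {t : G}
    (ht : t ∈ powerClosedPart U) (g : G) : g * t * g⁻¹ ∈ powerClosedPart U := fun j => by
  rw [conj_pow]
  exact hU _ (ht j) g

theorem card_closure_powerClosedPart_le [Finite G] {U : Set G}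
    (hcomm : ∀ a ∈ U, ∀ b ∈ U, Commute a b) :
    Nat.card (closure (powerClosedPart U)) ≤ U.ncard ^ U.ncard := by
  rcases (powerClosedPart U).eq_empty_or_nonempty with hempty | ⟨t, ht⟩
  · simpa [hempty] using Nat.one_le_iff_ne_zero.2 Nat.pow_self_pos.ne'
  have ncard_pos : 0 < U.ncard :=
    (orderOf_pos t).trans_le (orderOf_le_ncard_of_mem_powerClosedPart U.toFinite ht)
  calc Nat.card (closure (powerClosedPart U)) ≤ U.ncard ^ (powerClosedPart U).ncard :=
        card_closure_le_pow
          (fun a ha b hb => hcomm a (powerClosedPart_subset U ha) b (powerClosedPart_subset U hb))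
          fun t => orderOf_le_ncard_of_mem_powerClosedPart U.toFinite
    _ ≤ U.ncard ^ U.ncard :=
        Nat.pow_le_pow_right ncard_pos (Set.ncard_le_ncard (powerClosedPart_subset U) U.toFinite)

theorem pow_self_mul_pow_sq_le {a m : ℕ} (h : a < m) : m ^ m * a ^ a ^ 2 ≤ m ^ m ^ 2 :=
  calc m ^ m * a ^ a ^ 2 ≤ m ^ m * m ^ a ^ 2 := by gcongr
    _ = m ^ (m + a ^ 2) := (pow_add m m _).symm
    _ ≤ m ^ m ^ 2 := Nat.pow_le_pow_right (by omega) (by nlinarith)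

theorem card_lowerCentralSeries_le_of_commute [Finite G] {n : ℕ}
    (hcomm : ∀ a ∈ finiteUniformCommutators G (n + 1), ∀ b ∈ finiteUniformCommutators G (n + 1),
      Commute a b) :
    Nat.card ((⊤ : Subgroup G).lowerCentralSeries n) ≤
      (finiteUniformCommutators G (n + 1)).ncard ^
        (finiteUniformCommutators G (n + 1)).ncard ^ 2 := by
  induction hm : (finiteUniformCommutators G (n + 1)).ncard using Nat.strong_induction_on
    generalizing G with
  | _ m ih =>
  subst hm
  let U := finiteUniformCommutators G (n + 1)
  by_cases h : powerClosedPart U ⊆ {1}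
  · rw [lowerCentralSeries_eq_bot_of_commute hcomm h, card_bot]
    exact pow_pos (ncard_finiteUniformCommutators_pos _) _
  · obtain ⟨t, ht, ht_ne⟩ := Set.not_subset.1 h
    let T := closure (powerClosedPart U)
    have : T.Normal := normal_closure_of_conj_mem fun t ht =>
      conj_mem_powerClosedPart (fun u hu => conj_mem_finiteUniformCommutators hu) ht
    have mk_surjective := QuotientGroup.mk'_surjective T
    have ncard_lt := ncard_finiteUniformCommutators_lt_of_surjective mk_surjective
      (powerClosedPart_subset U ht) ht_ne ((QuotientGroup.eq_one_iff t).2 (subset_closure ht))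
    have hcomm_quotient := commute_finiteUniformCommutators_of_surjective mk_surjective
      fun a ha b hb => (hcomm a ha b hb).map (QuotientGroup.mk' T)
    calc Nat.card ((⊤ : Subgroup G).lowerCentralSeries n)
        ≤ Nat.card T * Nat.card ((⊤ : Subgroup (G ⧸ T)).lowerCentralSeries n) :=
          card_lowerCentralSeries_le_mul_quotient T n
      _ ≤ _ := Nat.mul_le_mul (card_closure_powerClosedPart_le hcomm)
          (ih _ ncard_lt hcomm_quotient rfl)
      _ ≤ U.ncard ^ U.ncard ^ 2 := pow_self_mul_pow_sq_le ncard_lt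

/-- A bound for the order of a term of the lower central series of a finite group in terms of the
number `m` of its uniform commutators. The first factor bounds the commutator subgroup of the
subgroup they generate, the second factor the image modulo this commutator subgroup. -/
def orderBound (m : ℕ) : ℕ :=
  m.factorial ^ (m.factorial ^ 3 + 1) * m ^ m ^ 2

theorem monotone_orderBound : Monotone orderBound := by
  have pow_le_pow_of_le {a b c d : ℕ} (hab : a ≤ b) (hcd : c ≤ d) (hb : 0 < b) :
      a ^ c ≤ b ^ d :=
    (Nat.pow_le_pow_left hab c).trans (Nat.pow_le_pow_right hb hcd)
  intro a b hab
  rcases b.eq_zero_or_pos with rfl | hb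
  · rw [Nat.le_zero.1 hab]
  have factorial_le := Nat.factorial_le hab
  exact Nat.mul_le_mul (pow_le_pow_of_le factorial_le (by gcongr) b.factorial_pos)
    (pow_le_pow_of_le hab (by gcongr) hb)

theorem card_lowerCentralSeries_le_orderBound [Finite G] (n : ℕ) :
    Nat.card ((⊤ : Subgroup G).lowerCentralSeries n) ≤
      orderBound (finiteUniformCommutators G (n + 1)).ncard := by
  let U := finiteUniformCommutators G (n + 1)
  have hconj (u : G) (hu : u ∈ U) (g : G) : g * u * g⁻¹ ∈ U :=
    conj_mem_finiteUniformCommutators hu g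
  have := normal_closure_of_conj_mem hconj
  let N : Subgroup G := ⁅closure U, closure U⁆
  let V := finiteUniformCommutators (G ⧸ N) (n + 1)
  have mk_surjective := QuotientGroup.mk'_surjective N
  have ncard_le : V.ncard ≤ U.ncard :=
    ncard_finiteUniformCommutators_le_of_surjective mk_surjective (n + 1)
  have hcomm : ∀ a ∈ V, ∀ b ∈ V, Commute a b :=
    commute_finiteUniformCommutators_of_surjective mk_surjective fun a ha b hb => by
      rw [← commutatorElement_eq_one_iff_commute, ← map_commutatorElement]
      exact (QuotientGroup.eq_one_iff _).2
        (commutator_mem_commutator (subset_closure ha) (subset_closure hb))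
  calc Nat.card ((⊤ : Subgroup G).lowerCentralSeries n)
      ≤ Nat.card N * Nat.card ((⊤ : Subgroup (G ⧸ N)).lowerCentralSeries n) :=
        card_lowerCentralSeries_le_mul_quotient N n
    _ ≤ U.ncard.factorial ^ (U.ncard.factorial ^ 3 + 1) * V.ncard ^ V.ncard ^ 2 :=
        Nat.mul_le_mul (card_commutator_closure_le hconj)
          (card_lowerCentralSeries_le_of_commute hcomm)
    _ ≤ orderBound U.ncard := Nat.mul_le_mul_left _
        ((Nat.pow_le_pow_left ncard_le _).trans
          (Nat.pow_le_pow_right (ncard_finiteUniformCommutators_pos _) (by gcongr)))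

end Bounds

section Profinite

variable {G : Type*} [Group G] [TopologicalSpace G] [IsTopologicalGroup G]

theorem isClosed_preimage_mk' (U : OpenNormalSubgroup G) (A : Set (G ⧸ U.toSubgroup)) :
    IsClosed (QuotientGroup.mk' U.toSubgroup ⁻¹' A) :=
  have := QuotientGroup.discreteTopology (N := U.toSubgroup) U.isOpen'
  (isClosed_discrete A).preimage QuotientGroup.continuous_mk

theorem map_mk'_procyclic (U : OpenNormalSubgroup G) (g : G) :
    (procyclic g).map (QuotientGroup.mk' U.toSubgroup) =
      zpowers (QuotientGroup.mk' U.toSubgroup g) := by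
  apply le_antisymm
  · rw [map_le_iff_le_comap]
    exact topologicalClosure_minimal _ (zpowers_le.2 (mem_zpowers _))
      (isClosed_preimage_mk' U (zpowers (QuotientGroup.mk' U.toSubgroup g)))
  · exact zpowers_le.2 ⟨g, le_topologicalClosure _ (mem_zpowers g), rfl⟩

theorem index_subgroupOf_procyclic (U : OpenNormalSubgroup G) (g : G) :
    (U.toSubgroup.subgroupOf (procyclic g)).index =
      orderOf (QuotientGroup.mk' U.toSubgroup g) := by
  rw [← Nat.card_zpowers, ← map_mk'_procyclic, ← relIndex_ker, QuotientGroup.ker_mk']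
  rfl

variable [CompactSpace G]

theorem primeFactors_orderOf_mk'_antitone {U V : OpenNormalSubgroup G} (h : U ≤ V) (g : G) :
    (orderOf (QuotientGroup.mk' V.toSubgroup g)).primeFactors ⊆
      (orderOf (QuotientGroup.mk' U.toSubgroup g)).primeFactors :=
  Nat.primeFactors_mono (orderOf_map_dvd (QuotientGroup.map U.toSubgroup V.toSubgroup (.id G) h) _)
    (orderOf_pos _).ne'

theorem exists_lift_forall_primeFactors_orderOf_subset (N : OpenNormalSubgroup G)
    (x : G ⧸ N.toSubgroup) :
    ∃ y : G, QuotientGroup.mk' N.toSubgroup y = x ∧ ∀ U : OpenNormalSubgroup G,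
      (orderOf (QuotientGroup.mk' U.toSubgroup y)).primeFactors ⊆ (orderOf x).primeFactors := by
  let S (U : OpenNormalSubgroup G) : Set G :=
    {y | QuotientGroup.mk' N.toSubgroup y = x ∧
      (orderOf (QuotientGroup.mk' U.toSubgroup y)).primeFactors ⊆ (orderOf x).primeFactors}
  have isClosed_S (U : OpenNormalSubgroup G) : IsClosed (S U) :=
    (isClosed_preimage_mk' N {z | z = x}).inter
      (isClosed_preimage_mk' U {z | (orderOf z).primeFactors ⊆ (orderOf x).primeFactors})
  have nonempty_S (U : OpenNormalSubgroup G) : (S U).Nonempty := by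
    obtain ⟨w, hw⟩ := QuotientGroup.mk'_surjective N.toSubgroup x
    obtain ⟨z, hz, hz'⟩ := exists_lift_primeFactors_orderOf
      (QuotientGroup.map (U ⊓ N).toSubgroup N.toSubgroup (.id G) (inf_le_right : U ⊓ N ≤ N))
      (isOfFinOrder_of_finite (QuotientGroup.mk' (U ⊓ N).toSubgroup w))
    obtain ⟨y, rfl⟩ := QuotientGroup.mk'_surjective _ z
    exact ⟨y, hz.trans hw,
      hw ▸ (primeFactors_orderOf_mk'_antitone (inf_le_left : U ⊓ N ≤ U) y).trans hz'.le⟩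
  have directed_S : Directed (fun A B => A ⊇ B) S := fun U V =>
    ⟨U ⊓ V, fun y hy => ⟨hy.1, (primeFactors_orderOf_mk'_antitone inf_le_left y).trans hy.2⟩,
      fun y hy => ⟨hy.1, (primeFactors_orderOf_mk'_antitone inf_le_right y).trans hy.2⟩⟩
  have : Nonempty (OpenNormalSubgroup G) := ⟨N⟩
  obtain ⟨y, hy⟩ := IsCompact.nonempty_iInter_of_directed_nonempty_isCompact_isClosed S directed_S
    nonempty_S (fun U => (isClosed_S U).isCompact) isClosed_S
  rw [Set.mem_iInter] at hy
  exact ⟨y, (hy N).1, fun U => (hy U).2⟩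

variable [TotallyDisconnectedSpace G]

theorem mem_elementPrimes_iff {g : G} {p : Nat.Primes} :
    p ∈ elementPrimes g ↔
      ∃ U : OpenNormalSubgroup G, (p : ℕ) ∣ orderOf (QuotientGroup.mk' U.toSubgroup g) := by
  have mem_iff_dvd_index : p ∈ elementPrimes g ↔
      ∃ V : OpenNormalSubgroup (procyclic g), (p : ℕ) ∣ V.toSubgroup.index := by
    simp only [elementPrimes, primeDivisors, steinitzOrder, Set.mem_ofPred_eq, ne_eq,
      ENat.iSup_eq_zero, not_forall, emultiplicity_eq_zero, not_not]
  simp only [mem_iff_dvd_index, ← index_subgroupOf_procyclic]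
  constructor
  · rintro ⟨V, hV⟩
    obtain ⟨W, hW, hWV⟩ := isOpen_induced_iff.1 V.isOpen'
    have one_mem_preimage : (1 : procyclic g) ∈ Subtype.val ⁻¹' W := hWV ▸ V.one_mem'
    obtain ⟨U, hU⟩ :=
      ProfiniteGrp.exist_openNormalSubgroup_sub_open_nhds_of_one hW one_mem_preimage
    refine ⟨U, hV.trans (index_dvd_of_le fun x hx => ?_)⟩
    exact hWV.le (hU hx : x ∈ Subtype.val ⁻¹' W)
  · rintro ⟨U, hU⟩
    exact ⟨{ toSubgroup := U.toSubgroup.subgroupOf (procyclic g)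
             isOpen' := U.isOpen'.preimage continuous_subtype_val
             isNormal' := inferInstance }, hU⟩

theorem exists_lift_elementPrimes (N : OpenNormalSubgroup G) (x : G ⧸ N.toSubgroup) :
    ∃ y : G, QuotientGroup.mk' N.toSubgroup y = x ∧
      elementPrimes y = {p : Nat.Primes | (p : ℕ) ∈ (orderOf x).primeFactors} := by
  obtain ⟨y, rfl, hy⟩ := exists_lift_forall_primeFactors_orderOf_subset N x
  refine ⟨y, rfl, Set.ext fun p => mem_elementPrimes_iff.trans ⟨?_, ?_⟩⟩
  · rintro ⟨U, hU⟩
    exact hy U (Nat.mem_primeFactors.2 ⟨p.2, hU, (orderOf_pos _).ne'⟩)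
  · exact fun hp => ⟨N, Nat.dvd_of_mem_primeFactors hp⟩

theorem finiteUniformCommutators_quotient_subset_image (N : OpenNormalSubgroup G) (k : ℕ) :
    finiteUniformCommutators (G ⧸ N.toSubgroup) k ⊆
      QuotientGroup.mk' N.toSubgroup '' uniformCommutators G k := by
  rintro _ ⟨x, hx, rfl⟩
  choose y hyx hy using fun i => exists_lift_elementPrimes N (x i)
  refine ⟨leftNormed k y, ⟨y, fun i j => ?_, rfl⟩, ?_⟩
  · rw [hy, hy, hx i j]
  · rw [map_leftNormed, show QuotientGroup.mk' N.toSubgroup ∘ y = x from funext hyx]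

theorem ncard_finiteUniformCommutators_quotient_le {k m : ℕ}
    (hU : (uniformCommutators G k).encard ≤ m) (N : OpenNormalSubgroup G) :
    (finiteUniformCommutators (G ⧸ N.toSubgroup) k).ncard ≤ m := by
  rw [← Nat.cast_le (α := ℕ∞), (Set.toFinite _).cast_ncard_eq]
  exact (Set.encard_le_encard (finiteUniformCommutators_quotient_subset_image N k)).trans
    ((Set.encard_image_le _ _).trans hU)

theorem exists_openNormalSubgroup_injOn_mk' {t : Set G} (ht : t.Finite) :
    ∃ U : OpenNormalSubgroup G, Set.InjOn (QuotientGroup.mk' U.toSubgroup) t := by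
  let D : Set G := Set.image2 (fun a b => a⁻¹ * b) t t \ {1}
  have finite_D : D.Finite := (ht.image2 _ ht).sdiff
  obtain ⟨U, hU⟩ := ProfiniteGrp.exist_openNormalSubgroup_sub_open_nhds_of_one
    finite_D.isClosed.isOpen_compl fun h : 1 ∈ D => h.2 rfl
  refine ⟨U, fun a ha b hb hab => ?_⟩
  by_contra hne
  exact hU (QuotientGroup.eq.1 hab) ⟨⟨a, ha, b, hb, rfl⟩, fun h => hne (inv_mul_eq_one.1 h)⟩

theorem encard_le_of_forall_openNormalSubgroup {L : Set G} {B : ℕ}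
    (h : ∀ N : OpenNormalSubgroup G, (QuotientGroup.mk' N.toSubgroup '' L).encard ≤ B) :
    L.encard ≤ B := by
  by_contra! hlt
  obtain ⟨t, htL, ht⟩ := Set.exists_subset_encard_eq (Order.add_one_le_of_lt hlt)
  obtain ⟨U, hU⟩ := exists_openNormalSubgroup_injOn_mk'
    (Set.finite_of_encard_eq_coe (k := B + 1) ht)
  have encard_le := (Set.encard_le_encard (Set.image_mono htL)).trans (h U)
  rw [hU.encard_image, ht] at encard_le
  exact encard_le.not_gt (by exact_mod_cast Nat.lt_succ_self B)

theorem encard_lowerCentralSeries_le {n m : ℕ}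
    (hU : (uniformCommutators G (n + 1)).encard ≤ m) :
    ((⊤ : Subgroup G).lowerCentralSeries n : Set G).encard ≤ orderBound m := by
  refine encard_le_of_forall_openNormalSubgroup fun N => ?_
  rw [← coe_map, map_lowerCentralSeries,
    map_top_of_surjective _ (QuotientGroup.mk'_surjective N.toSubgroup),
    ← (Set.toFinite _).cast_ncard_eq, Nat.cast_le]
  exact (card_lowerCentralSeries_le_orderBound n).trans
    (monotone_orderBound (ncard_finiteUniformCommutators_quotient_le hU N))

end Profinite

end UniformComm

theorem mainTheorem4 :
    ∃ f : ℕ → ℕ, ∀ (k m : ℕ), 1 ≤ k → 1 ≤ m →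
      ∀ (G : Type*) [Group G] [TopologicalSpace G] [IsTopologicalGroup G] [CompactSpace G]
        [TotallyDisconnectedSpace G],
        (UniformComm.uniformCommutators G k).encard ≤ (m : ℕ∞) →
          Finite (UniformComm.gammaSubgroup G k) ∧
            Nat.card (UniformComm.gammaSubgroup G k) ≤ f m := by
  refine ⟨UniformComm.orderBound, fun k m hk _ G _ _ _ _ _ hU => ?_⟩
  obtain ⟨n, rfl⟩ := Nat.exists_eq_add_of_le' hk
  have encard_le := UniformComm.encard_lowerCentralSeries_le hU
  have finite := Set.finite_of_encard_le_coe encard_le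
  have gamma_eq : UniformComm.gammaSubgroup G (n + 1) = (⊤ : Subgroup G).lowerCentralSeries n :=
    SetLike.coe_injective finite.isClosed.closure_eq
  rw [gamma_eq]
  rw [← finite.cast_ncard_eq, Nat.cast_le] at encard_le
  exact ⟨finite, encard_le⟩
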